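/- Let $n\ge 0$ and let $\mathcal A_1,\dots,\mathcal A_n$ be (nonzero) unital C*-algebras, not necessarily finite-dimensional, none of which is one-dimensional, i.e. none is isomorphic to $\mathbb C$. Let $\mathcal A=\bigotimes_{i=1}^n\mathcal A_i$ be their minimal (spatial) C*-tensor product, and for each $i$ let $\tilde{\mathcal A}_i=\bigotimes_{j\ne i}\mathcal A_j$, viewed as a unital C*-subalgebra of $\mathcal A$. For $a\in\mathcal A$ put $$L_i(a)=2\inf\{\|a-c\| : c\in\tilde{\mathcal A}_i\},\qquad L_{qH}(a)=\max_{1\le i\le n}L_i(a)$$ (the maximum being $0$ if $n=0$). Let $S(\mathcal A)$ be the set of states (positive linear functionals of norm one) of $\mathcal A$, and put $$d(\mu,\nu)=\sup\{|\mu(a)-\nu(a)| : a\in\mathcal A,\ L_{qH}(a)\le 1\}\in[0,\infty]\quad(\mu,\nu\in S(\mathcal A)),\qquad L^0(a)=\inf_{z\in\mathbb C}\|a-z1_{\mathcal A}\| .$$ The radius of $(\mathcal A,L_{qH})$ is the smallest real $r\ge 0$ such that $d(\mu,\nu)\le 2r$ for all $\mu,\nu\in S(\mathcal A)$ and $L^0(a)\le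 r\,L_{qH}(a)$ for all self-adjoint $a\in\mathcal A$, and its diameter is $2r$. Then the radius of $(\mathcal A,L_{qH})$ exists, and the diameter of $(\mathcal A,L_{qH})$ is exactly $n$. -/

import Mathlib

open scoped ENNReal ComplexOrder

namespace QuantumHamming

noncomputable section

set_option linter.unusedSectionVars false

universe u v

/-! ### The Hilbert space tensor product of a finite family of Hilbert spaces -/

section HilbertTensor

variable {ι : Type v} [Fintype ι] (H : ι → Type u)
  [∀ i, NormedAddCommGroup (H i)] [∀ i, InnerProductSpace ℂ (H i)]

/-- The algebraic tensor product of the spaces `H i`, as a type of its own: it carries the norm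
coming from the inner product `⟪⊗ vᵢ, ⊗ wᵢ⟫ = ∏ ⟪vᵢ, wᵢ⟫`. -/
def PreTensor : Type (max v u) := PiTensorProduct ℂ H

instance : AddCommGroup (PreTensor H) := inferInstanceAs (AddCommGroup (PiTensorProduct ℂ H))
instance : Module ℂ (PreTensor H) := inferInstanceAs (Module ℂ (PiTensorProduct ℂ H))

variable {H}

/-- The elementary tensor `⊗ vᵢ`. -/
def PreTensor.mk (w : ∀ i, H i) : PreTensor H := PiTensorProduct.tprod ℂ w

theorem PreTensor.exists_sum (x : PreTensor H) :
    ∃ (m : ℕ) (c : Fin m → ℂ) (w : Fin m → ∀ i, H i), x = ∑ k, c k • PreTensor.mk (w k) := by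
  have hx : (show PiTensorProduct ℂ H from x) ∈
      Submodule.span ℂ (Set.range (PiTensorProduct.tprod ℂ (s := H))) := by
    rw [PiTensorProduct.span_tprod_eq_top]; trivial
  obtain ⟨m, c, g, hg⟩ := Submodule.mem_span_set'.1 hx
  choose w hw using fun k => (g k).2
  refine ⟨m, c, w, ?_⟩
  rw [← show _ = x from hg]
  exact Finset.sum_congr rfl fun k _ => congrArg (c k • ·) (hw k).symm

/-- The linear functional `⊗ vᵢ ↦ ∏ ⟪wᵢ, vᵢ⟫`. -/
def prodForm (w : ∀ i, H i) : PiTensorProduct ℂ H →ₗ[ℂ] ℂ :=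
  PiTensorProduct.lift ((MultilinearMap.mkPiAlgebra ℂ ι ℂ).compLinearMap
    fun i => (innerSL ℂ (w i)).toLinearMap)

theorem prodForm_tprod (w x : ∀ i, H i) :
    prodForm w (PiTensorProduct.tprod ℂ x) = ∏ i, inner ℂ (w i) (x i) := by
  simp [prodForm]

theorem prodForm_update_add [DecidableEq ι] (w : ∀ i, H i) (i : ι) (a b : H i) :
    prodForm (Function.update w i (a + b)) =
      prodForm (Function.update w i a) + prodForm (Function.update w i b) := by
  ext x
  simp only [LinearMap.compMultilinearMap_apply, LinearMap.add_apply, prodForm_tprod]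
  simp_rw [← Finset.mul_prod_erase Finset.univ _ (Finset.mem_univ i)]
  have h : ∀ c : H i, ∏ j ∈ Finset.univ.erase i, inner ℂ (Function.update w i c j) (x j) =
      ∏ j ∈ Finset.univ.erase i, inner ℂ (w j) (x j) := fun c =>
    Finset.prod_congr rfl fun j hj => by rw [Function.update_of_ne (Finset.ne_of_mem_erase hj)]
  simp only [h, Function.update_self, inner_add_left, add_mul]

theorem prodForm_update_smul [DecidableEq ι] (w : ∀ i, H i) (i : ι) (c : ℂ) (a : H i) :
    prodForm (Function.update w i (c • a)) =
      (starRingEnd ℂ c) • prodForm (Function.update w i a) := by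
  ext x
  simp only [LinearMap.compMultilinearMap_apply, LinearMap.smul_apply, prodForm_tprod]
  simp_rw [← Finset.mul_prod_erase Finset.univ _ (Finset.mem_univ i)]
  have h : ∀ c : H i, ∏ j ∈ Finset.univ.erase i, inner ℂ (Function.update w i c j) (x j) =
      ∏ j ∈ Finset.univ.erase i, inner ℂ (w j) (x j) := fun c =>
    Finset.prod_congr rfl fun j hj => by rw [Function.update_of_ne (Finset.ne_of_mem_erase hj)]
  simp only [h, Function.update_self, inner_smul_left, smul_eq_mul, mul_assoc]

/-- `w ↦ (⊗ vᵢ ↦ ∏ ⟪vᵢ, wᵢ⟫)`, multilinear with values in conjugate-linear functionals. -/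
def tensorForm : MultilinearMap ℂ H (PiTensorProduct ℂ H →ₗ⋆[ℂ] ℂ) where
  toFun w := (starLinearEquiv ℂ : ℂ ≃ₗ⋆[ℂ] ℂ).toLinearMap.comp (prodForm w)
  map_update_add' w i a b := by
    ext x; simp [prodForm_update_add]
  map_update_smul' w i c a := by
    ext x; simp [prodForm_update_smul]

instance : Inner ℂ (PreTensor H) where
  inner x y := PiTensorProduct.lift tensorForm y x

theorem inner_mk (x y : ∀ i, H i) :
    inner ℂ (PreTensor.mk x) (PreTensor.mk y) = ∏ i, inner ℂ (x i) (y i) := by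
  change PiTensorProduct.lift tensorForm (PiTensorProduct.tprod ℂ y) (PiTensorProduct.tprod ℂ x) = _
  simp [tensorForm, prodForm_tprod]

theorem pre_add_left (x y z : PreTensor H) :
    inner ℂ (x + y) z = inner ℂ x z + inner ℂ y z :=
  map_add (PiTensorProduct.lift tensorForm z) x y

theorem pre_smul_left (c : ℂ) (x z : PreTensor H) :
    inner ℂ (c • x) z = starRingEnd ℂ c * inner ℂ x z :=
  map_smulₛₗ (PiTensorProduct.lift tensorForm z) c x

theorem pre_add_right (x y z : PreTensor H) :
    inner ℂ z (x + y) = inner ℂ z x + inner ℂ z y :=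
  (congrArg (fun f => f z) (map_add (PiTensorProduct.lift (tensorForm (H := H))) x y) :)

theorem pre_smul_right (c : ℂ) (x z : PreTensor H) :
    inner ℂ z (c • x) = c * inner ℂ z x :=
  (congrArg (fun f => f z) (map_smul (PiTensorProduct.lift (tensorForm (H := H))) c x) :)

theorem pre_sum (m m' : ℕ) (c : Fin m → ℂ) (d : Fin m' → ℂ) (x : Fin m → PreTensor H)
    (y : Fin m' → PreTensor H) :
    inner ℂ (∑ k, c k • x k) (∑ l, d l • y l) =
      ∑ k, ∑ l, starRingEnd ℂ (c k) * d l * inner ℂ (x k) (y l) := by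
  have h1 : ∀ z : PreTensor H, inner ℂ (∑ k, c k • x k) z =
      ∑ k, starRingEnd ℂ (c k) * inner ℂ (x k) z := fun z => by
    refine (map_sum (PiTensorProduct.lift tensorForm z) _ _).trans
      (Finset.sum_congr rfl fun k _ => pre_smul_left _ _ _)
  have h2 : ∀ z : PreTensor H, inner ℂ z (∑ l, d l • y l) =
      ∑ l, d l * inner ℂ z (y l) := fun z => by
    refine (congrArg (fun f => f z)
      (map_sum (PiTensorProduct.lift (tensorForm (H := H))) (fun l => d l • y l) _)).trans ?_
    refine (LinearMap.sum_apply _ _ _).trans ?_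
    exact Finset.sum_congr rfl fun k _ => pre_smul_right _ _ _
  simp_rw [h1, h2, Finset.mul_sum, mul_assoc]

theorem posSemidef_prod {𝕜 : Type*} [RCLike 𝕜] {m : ℕ} (s : Finset ι)
    (M : ι → Matrix (Fin m) (Fin m) 𝕜) (hM : ∀ i ∈ s, (M i).PosSemidef) :
    (Matrix.of fun k l => ∏ i ∈ s, M i k l).PosSemidef := by
  classical
  induction s using Finset.induction_on with
  | empty =>
    have := Matrix.posSemidef_gram (𝕜 := 𝕜) (fun _ : Fin m => (1 : 𝕜))
    convert this using 1
    ext k l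
    simp [Matrix.gram_apply]
  | insert a s ha ih =>
    have h := (hM a (Finset.mem_insert_self a s)).hadamard
      (ih fun i hi => hM i (Finset.mem_insert_of_mem hi))
    convert h using 1
    ext k l
    simp [Finset.prod_insert ha, Matrix.hadamard_apply]

theorem re_sum_nonneg_of_posSemidef {𝕜 : Type*} [RCLike 𝕜] {m : ℕ}
    {M : Matrix (Fin m) (Fin m) 𝕜} (hM : M.PosSemidef) (c : Fin m → 𝕜) :
    0 ≤ RCLike.re (∑ k, ∑ l, starRingEnd 𝕜 (c k) * c l * M k l) := by
  have h := (RCLike.nonneg_iff.mp (hM.dotProduct_mulVec_nonneg c)).1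
  simp only [dotProduct, Matrix.mulVec, Finset.mul_sum] at h
  refine h.trans_eq (congrArg _ (Finset.sum_congr rfl fun k _ =>
    Finset.sum_congr rfl fun l _ => ?_))
  simp only [Pi.star_apply, RCLike.star_def]
  ring

theorem pre_re_inner_self_nonneg (x : PreTensor H) : 0 ≤ RCLike.re (inner ℂ x x) := by
  obtain ⟨m, c, w, rfl⟩ := PreTensor.exists_sum x
  rw [pre_sum]
  have h := re_sum_nonneg_of_posSemidef (posSemidef_prod (𝕜 := ℂ) Finset.univ
    (fun i => Matrix.gram ℂ fun k => w k i) fun i _ => Matrix.posSemidef_gram ℂ _) c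
  simpa only [inner_mk, Matrix.of_apply, Matrix.gram_apply] using h

variable (H) in
/-- The inner product of the algebraic tensor product. -/
abbrev preTensorCore : PreInnerProductSpace.Core ℂ (PreTensor H) where
  inner x y := inner ℂ x y
  conj_inner_symm x y := by
    obtain ⟨m, c, w, rfl⟩ := PreTensor.exists_sum x
    obtain ⟨m', c', w', rfl⟩ := PreTensor.exists_sum y
    rw [pre_sum, pre_sum, Finset.sum_comm, map_sum (starRingEnd ℂ)]
    refine Finset.sum_congr rfl fun k _ => ?_
    rw [map_sum (starRingEnd ℂ)]
    refine Finset.sum_congr rfl fun l _ => ?_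
    simp only [inner_mk, map_mul, map_prod, inner_conj_symm, starRingEnd_self_apply]
    ring
  re_inner_nonneg x := pre_re_inner_self_nonneg x
  add_left := pre_add_left
  smul_left x y c := pre_smul_left c x y

instance : SeminormedAddCommGroup (PreTensor H) :=
  InnerProductSpace.Core.toSeminormedAddCommGroup (c := preTensorCore H)
instance : InnerProductSpace ℂ (PreTensor H) :=
  InnerProductSpace.ofCore (preTensorCore H)

variable (H) in
/-- The Hilbert space tensor product `⊗ᵢ H i`. -/
abbrev HilbertTensor : Type (max v u) := UniformSpace.Completion (PreTensor H)

variable [DecidableEq ι]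

/-- The operator `1 ⊗ ⋯ ⊗ T ⊗ ⋯ ⊗ 1`, with `T` in position `j`, on the algebraic tensor product. -/
def legLin (j : ι) (T : H j →L[ℂ] H j) : PreTensor H →ₗ[ℂ] PreTensor H :=
  PiTensorProduct.map (Function.update (fun _ => LinearMap.id) j T.toLinearMap)

theorem legLin_mk (j : ι) (T : H j →L[ℂ] H j) (w : ∀ i, H i) :
    legLin j T (PreTensor.mk w) = PreTensor.mk (Function.update w j (T (w j))) := by
  refine (PiTensorProduct.map_tprod _ _).trans (congrArg (PiTensorProduct.tprod ℂ) ?_)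
  funext i
  by_cases h : i = j
  · subst h; simp
  · simp [Function.update_of_ne h]

theorem norm_legLin_le (j : ι) (T : H j →L[ℂ] H j) (x : PreTensor H) :
    ‖legLin j T x‖ ≤ ‖T‖ * ‖x‖ := by
  obtain ⟨m, c, w, rfl⟩ := PreTensor.exists_sum x
  have hG := posSemidef_prod (𝕜 := ℂ) (Finset.univ.erase j)
    (fun i => Matrix.gram ℂ fun k => w k i) fun i _ => Matrix.posSemidef_gram ℂ _
  have h := re_sum_nonneg_of_posSemidef ((Matrix.posSemidef_opNorm_smul_gram_sub_gram
    (𝕜 := ℂ) (fun k => w k j) T).hadamard hG) c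
  rw [← sq_le_sq₀ (norm_nonneg _) (by positivity), mul_pow, ← sub_nonneg]
  have e1 := inner_self_eq_norm_sq_to_K (𝕜 := ℂ) (∑ k, c k • PreTensor.mk (w k))
  have e2 := inner_self_eq_norm_sq_to_K (𝕜 := ℂ) (legLin j T (∑ k, c k • PreTensor.mk (w k)))
  refine h.trans_eq ?_
  refine (congrArg RCLike.re (?_ : _ = (((‖T‖ ^ 2 * ‖∑ k, c k • PreTensor.mk (w k)‖ ^ 2 -
    ‖legLin j T (∑ k, c k • PreTensor.mk (w k))‖ ^ 2 : ℝ)) : ℂ))).trans (RCLike.ofReal_re _)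
  push_cast
  erw [← e1, ← e2]
  simp only [map_sum, map_smul, legLin_mk]
  rw [pre_sum, pre_sum]
  simp_rw [Finset.mul_sum, ← Finset.sum_sub_distrib]
  refine Finset.sum_congr rfl fun k _ => Finset.sum_congr rfl fun l _ => ?_
  simp only [inner_mk, Matrix.hadamard_apply, Matrix.sub_apply, Matrix.smul_apply,
    Matrix.gram_apply, Matrix.of_apply, Function.comp_apply]
  rw [← Finset.mul_prod_erase Finset.univ _ (Finset.mem_univ j),
    ← Finset.mul_prod_erase Finset.univ _ (Finset.mem_univ j)]
  have hp : ∏ i ∈ Finset.univ.erase j, inner ℂ (Function.update (w k) j (T (w k j)) i)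
      (Function.update (w l) j (T (w l j)) i) =
      ∏ i ∈ Finset.univ.erase j, inner ℂ (w k i) (w l i) :=
    Finset.prod_congr rfl fun i hi => by
      rw [Function.update_of_ne (Finset.ne_of_mem_erase hi),
        Function.update_of_ne (Finset.ne_of_mem_erase hi)]
  rw [hp]
  simp only [Function.update_self, RCLike.real_smul_eq_coe_mul,
    RCLike.ofReal_eq_complex_ofReal]
  push_cast
  ring

/-- The bounded operator `1 ⊗ ⋯ ⊗ T ⊗ ⋯ ⊗ 1` on the algebraic tensor product. -/
def legPre (j : ι) (T : H j →L[ℂ] H j) : PreTensor H →L[ℂ] PreTensor H :=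
  (legLin j T).mkContinuous ‖T‖ (norm_legLin_le j T)

theorem legPre_mk (j : ι) (T : H j →L[ℂ] H j) (w : ∀ i, H i) :
    legPre j T (PreTensor.mk w) = PreTensor.mk (Function.update w j (T (w j))) :=
  legLin_mk j T w

theorem legLin_add (j : ι) (S T : H j →L[ℂ] H j) : legLin j (S + T) = legLin j S + legLin j T :=
  PiTensorProduct.map_update_add (fun _ => LinearMap.id) j S.toLinearMap T.toLinearMap

theorem legLin_smul (j : ι) (c : ℂ) (T : H j →L[ℂ] H j) : legLin j (c • T) = c • legLin j T :=
  PiTensorProduct.map_update_smul (fun _ => LinearMap.id) j c T.toLinearMap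

theorem legLin_mul (j : ι) (S T : H j →L[ℂ] H j) (x : PreTensor H) :
    legLin j (S * T) x = legLin j S (legLin j T x) := by
  obtain ⟨m, c, w, rfl⟩ := PreTensor.exists_sum x
  simp [map_sum, map_smul, legLin_mk]

theorem legLin_one (j : ι) (x : PreTensor H) : legLin j (1 : H j →L[ℂ] H j) x = x := by
  obtain ⟨m, c, w, rfl⟩ := PreTensor.exists_sum x
  simp [map_sum, map_smul, legLin_mk]

theorem legLin_adjoint [∀ i, CompleteSpace (H i)] (j : ι) (T : H j →L[ℂ] H j)
    (x y : PreTensor H) :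
    inner ℂ (legLin j (star T) x) y = inner ℂ x (legLin j T y) := by
  obtain ⟨m, c, w, rfl⟩ := PreTensor.exists_sum x
  obtain ⟨m', c', w', rfl⟩ := PreTensor.exists_sum y
  simp only [map_sum, map_smul, legLin_mk]
  rw [pre_sum, pre_sum]
  refine Finset.sum_congr rfl fun k _ => Finset.sum_congr rfl fun l _ => ?_
  rw [inner_mk, inner_mk, ← Finset.mul_prod_erase Finset.univ _ (Finset.mem_univ j),
    ← Finset.mul_prod_erase Finset.univ _ (Finset.mem_univ j)]
  congr 2
  · simp [ContinuousLinearMap.star_eq_adjoint, ContinuousLinearMap.adjoint_inner_left]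
  · refine Finset.prod_congr rfl fun i hi => ?_
    rw [Function.update_of_ne (Finset.ne_of_mem_erase hi),
      Function.update_of_ne (Finset.ne_of_mem_erase hi)]

/-- The unital `*`-homomorphism `T ↦ 1 ⊗ ⋯ ⊗ T ⊗ ⋯ ⊗ 1` from the bounded operators on `H j` to the
bounded operators on `⊗ᵢ H i`. -/
def leg [∀ i, CompleteSpace (H i)] (j : ι) :
    (H j →L[ℂ] H j) →⋆ₐ[ℂ] (HilbertTensor H →L[ℂ] HilbertTensor H) :=
  let f : (H j →L[ℂ] H j) →ₗ[ℂ] (HilbertTensor H →L[ℂ] HilbertTensor H) :=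
    { toFun := fun T => (legPre j T).completion
      map_add' := fun S T => by
        ext x
        induction x using UniformSpace.Completion.induction_on with
        | hp => apply isClosed_eq <;> fun_prop
        | ih x => simp [legPre, legLin_add, UniformSpace.Completion.coe_add]
      map_smul' := fun c T => by
        ext x
        induction x using UniformSpace.Completion.induction_on with
        | hp =>
          exact isClosed_eq (legPre j (c • T)).completion.continuous
            (c • (legPre j T).completion).continuous
        | ih x => simp [legPre, legLin_smul, UniformSpace.Completion.coe_smul] }
  have h1 : f 1 = 1 := by
    ext x
    induction x using UniformSpace.Completion.induction_on with
    | hp => exact isClosed_eq (f 1).continuous continuous_id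
    | ih x => simp [f, legPre, legLin_one]
  { f with
    map_one' := h1
    map_mul' := fun S T => by
      ext x
      induction x using UniformSpace.Completion.induction_on with
      | hp => exact isClosed_eq (f (S * T)).continuous ((f S) * (f T)).continuous
      | ih x => simp [f, legPre, legLin_mul]
    map_zero' := f.map_zero
    commutes' := fun c => by
      have : f (c • 1) = c • 1 := by rw [map_smul, h1]
      simpa [Algebra.algebraMap_eq_smul_one] using this
    map_star' := fun T => by
      refine (ContinuousLinearMap.eq_adjoint_iff (f (star T)) (f T)).mpr fun x y => ?_
      induction x, y using UniformSpace.Completion.induction_on₂ with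
      | hp => apply isClosed_eq <;> fun_prop
      | ih x y => simpa [f, legPre] using legLin_adjoint j T x y }

theorem leg_apply_coe [∀ i, CompleteSpace (H i)] (j : ι) (T : H j →L[ℂ] H j) (x : PreTensor H) :
    leg j T (x : HilbertTensor H) = ((legPre j T x : PreTensor H) : HilbertTensor H) := by
  change (legPre j T).completion x = _
  simp

end HilbertTensor

/-! ### States and the universal representation of a unital C*-algebra -/

section States

variable (A : Type u) [CStarAlgebra A]

/-- The states of a unital C*-algebra: the positive linear functionals of norm one. -/
structure State where
  /-- The underlying functional. -/
  toCLM : A →L[ℂ] ℂ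
  nonneg : ∀ a : A, 0 ≤ toCLM (star a * a)
  norm_eq_one : ‖toCLM‖ = 1

variable {A}

instance : CoeFun (State A) fun _ => A → ℂ := ⟨fun φ => φ.toCLM⟩

attribute [local instance] CStarAlgebra.spectralOrder CStarAlgebra.spectralOrderedRing

/-- A state, as a bundled positive linear map. -/
def State.toPositive (φ : State A) : A →ₚ[ℂ] ℂ :=
  PositiveLinearMap.mk₀ φ.toCLM.toLinearMap fun a ha => by
    obtain ⟨b, rfl⟩ := CStarAlgebra.nonneg_iff_eq_star_mul_self.mp ha
    exact φ.nonneg b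

/-- The Hilbert space of the GNS construction of a state. -/
abbrev State.GNS (φ : State A) : Type u := φ.toPositive.GNS

/-- The representation of the GNS construction of a state. -/
def State.rep (φ : State A) : A →⋆ₐ[ℂ] (φ.GNS →L[ℂ] φ.GNS) := φ.toPositive.gnsStarAlgHom

variable (A) in
/-- The Hilbert space of the universal representation: the Hilbert sum, over all states of `A`, of
the Hilbert spaces of the GNS construction. -/
abbrev UniversalSpace : Type u := lp (fun φ : State A => φ.GNS) 2

variable (A) in
/-- The universal representation of `A`: the direct sum of the GNS representations of all its
states. -/
def universalRep : A →⋆ₐ[ℂ] (UniversalSpace A →L[ℂ] UniversalSpace A) where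
  toFun a := lp.mapCLM 2 (fun φ : State A => φ.rep a) (norm_nonneg a)
    fun φ => NonUnitalStarAlgHom.norm_apply_le φ.rep a
  map_one' := by ext x φ; simp
  map_mul' a b := by ext x φ; simp
  map_zero' := by ext x φ; simp
  map_add' a b := by ext x φ; simp
  commutes' c := by ext x φ; simp [Algebra.algebraMap_eq_smul_one]
  map_star' a := by
    refine (ContinuousLinearMap.eq_adjoint_iff _ _).mpr fun x y => ?_
    rw [lp.inner_eq_tsum, lp.inner_eq_tsum]
    refine tsum_congr fun φ => ?_
    change inner ℂ (φ.rep (star a) (x φ)) (y φ) = inner ℂ (x φ) (φ.rep a (y φ))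
    rw [map_star, ContinuousLinearMap.star_eq_adjoint, ContinuousLinearMap.adjoint_inner_left]

end States

/-! ### The minimal C*-tensor product -/

section MinTensor

variable {ι : Type v} [Fintype ι] [DecidableEq ι] (A : ι → Type u) [∀ i, CStarAlgebra (A i)]

/-- The minimal (spatial) C*-tensor product `⊗ᵢ A i`, as an algebra of operators: represent each
`A i` faithfully on a Hilbert space (here by its universal representation), and take the
norm-closed unital `*`-algebra of operators on the tensor product of these Hilbert spaces that is
generated by all `1 ⊗ ⋯ ⊗ a ⊗ ⋯ ⊗ 1`. -/
def minTensorSubalgebra : StarSubalgebra ℂ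
    (HilbertTensor (fun i => UniversalSpace (A i)) →L[ℂ]
      HilbertTensor (fun i => UniversalSpace (A i))) :=
  (StarAlgebra.adjoin ℂ (⋃ i, Set.range fun a : A i =>
    leg (H := fun i => UniversalSpace (A i)) i (universalRep (A i) a))).topologicalClosure

/-- The minimal C*-tensor product `⊗ᵢ A i`. -/
abbrev MinTensor : Type (max v u) := minTensorSubalgebra A

instance : CStarAlgebra (MinTensor A) :=
  haveI : IsClosed (minTensorSubalgebra A : Set (HilbertTensor (fun i => UniversalSpace (A i)) →L[ℂ]
      HilbertTensor (fun i => UniversalSpace (A i)))) :=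
    StarSubalgebra.isClosed_topologicalClosure _
  StarSubalgebra.cstarAlgebra _

/-- The embedding `a ↦ 1 ⊗ ⋯ ⊗ a ⊗ ⋯ ⊗ 1` of `A i` into the tensor product. -/
def MinTensor.incl (i : ι) : A i →⋆ₐ[ℂ] MinTensor A :=
  ((leg (H := fun i => UniversalSpace (A i)) i).comp (universalRep (A i))).codRestrict
    (minTensorSubalgebra A) fun a =>
      StarSubalgebra.le_topologicalClosure _
        (StarAlgebra.subset_adjoin ℂ _ (Set.mem_iUnion.2 ⟨i, a, rfl⟩))

/-- The subalgebra `⊗_{j ≠ i} A j` of `⊗ⱼ A j`: the C*-subalgebra generated by the `A j`, `j ≠ i`. -/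
def MinTensor.compl (i : ι) : StarSubalgebra ℂ (MinTensor A) :=
  (StarAlgebra.adjoin ℂ (⋃ j ∈ ({i}ᶜ : Set ι), Set.range (MinTensor.incl A j))).topologicalClosure

/-- `L_i (a) = 2 inf {‖a - c‖ : c ∈ ⊗_{j ≠ i} A j}`. -/
def partialSeminorm (i : ι) (a : MinTensor A) : ℝ :=
  2 * ⨅ c : MinTensor.compl A i, ‖a - (c : MinTensor A)‖

/-- The quantum Hamming seminorm `L_qH (a) = max_i L_i (a)`. -/
def quantumHamming (a : MinTensor A) : ℝ := ⨆ i, partialSeminorm A i a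

end MinTensor

/-! ### The metric on states, radius and diameter -/

section Diameter

variable {A : Type u} [CStarAlgebra A]

/-- `d^L (μ, ν) = sup {|μ(a) - ν(a)| : L(a) ≤ 1}`, possibly infinite. -/
def stateDist (L : A → ℝ) (μ ν : State A) : ℝ≥0∞ :=
  ⨆ (a : A) (_ : L a ≤ 1), ENNReal.ofReal ‖μ a - ν a‖

/-- `L⁰(a) = inf {‖a - z 1‖ : z ∈ ℂ}`. -/
def scalarDist (a : A) : ℝ := ⨅ z : ℂ, ‖a - z • (1 : A)‖

/-- `r` is the radius of `(A, L)`: the smallest `r ≥ 0` such that `d^L(μ, ν) ≤ 2 r` for all states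
and `L⁰(a) ≤ r L(a)` for all self-adjoint `a`. -/
def IsRadius (L : A → ℝ) (r : ℝ) : Prop :=
  IsLeast {s : ℝ | 0 ≤ s ∧ (∀ μ ν : State A, stateDist L μ ν ≤ ENNReal.ofReal (2 * s)) ∧
    ∀ a : A, IsSelfAdjoint a → scalarDist a ≤ s * L a} r

/-- The diameter of `(A, L)` is twice its radius. -/
def IsDiameter (L : A → ℝ) (D : ℝ) : Prop := ∃ r : ℝ, IsRadius L r ∧ D = 2 * r

end Diameter

end

end QuantumHamming

/-! Upper bound: to compare two vectors `x`, `y` of the Hilbert tensor product, pass from one to the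
other a leg at a time. In the doubled space take `y ⊗ x`, exchange the two copies of the legs in a
set `S`, and let `T` act on the second copy. This gives a positive functional `crossForm … S`, which
for `S = ∅` is `‖y‖²⟪x, T x⟫` and for `S` everything is `‖x‖²⟪y, T y⟫`. Exchanges preserve inner
products, so all these functionals have the same norm `K = ‖y‖²‖x‖²`. Adding `i` to `S` does not
change the value at operators commuting with everything acting on leg `i`, in particular on the
subalgebra `⊗_{j ≠ i} A j` (`crossForm_insert`, `commute_leg_of_mem_compl`). Hence this step moves
the value at `a` by at most `2 ‖a - c‖ K` for each `c` in that subalgebra, so by at most `L_i(a) K`;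
the factor `2` in `L_i` is exactly what two functionals cost.

Summing over the legs, the numerical range of a self-adjoint `a` has length at most `n L(a)`, and
its midpoint is a scalar within `n L(a) / 2` of `a`. The bound on state distances follows: a phase
and a real part make `a` self-adjoint without increasing `L`, and subtracting a scalar does not
affect a difference of states.

Lower bound: each factor contains a self-adjoint `hᵢ` at distance at most `1/2` from the scalars and
two states that differ by `1` on it (`exists_isSelfAdjoint_states`). The sum of the `hᵢ`, placed in
their legs, has `L ≤ 1`, since replacing `hᵢ` by a scalar lands in the `i`-th subalgebra. The two
product states differ by `n` on this sum. -/

namespace QuantumHamming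

set_option linter.unusedSectionVars false

universe u v

/-! ### Vector functionals on a doubled space, written through Gram matrices. -/

section GramForm

variable {α E F : Type*} [Fintype α] [SeminormedAddCommGroup E] [InnerProductSpace ℂ E]
  [SeminormedAddCommGroup F] [InnerProductSpace ℂ F]

/-- The functional `T ↦ ∑ ⟪yₐ, y_b⟫ ⟪xₐ, T x_b⟫`: the vector functional of `∑ yₐ ⊗ xₐ`, evaluated
at `1 ⊗ T`. -/
noncomputable def gramForm (y : α → F) (x : α → E) : (E →L[ℂ] E) →ₗ[ℂ] ℂ where
  toFun T := ∑ a, ∑ b, inner ℂ (y a) (y b) * inner ℂ (x a) (T (x b))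
  map_add' S T := by
    simp [inner_add_right, mul_add, Finset.sum_add_distrib]
  map_smul' c T := by
    simp only [smul_apply, inner_smul_right, RingHom.id_apply, smul_eq_mul, Finset.mul_sum]
    exact Finset.sum_congr rfl fun a _ => Finset.sum_congr rfl fun b _ => by ring

theorem gramForm_apply (y : α → F) (x : α → E) (T : E →L[ℂ] E) :
    gramForm y x T = ∑ a, ∑ b, inner ℂ (y a) (y b) * inner ℂ (x a) (T (x b)) := rfl

/-- The form is a positive functional, so its norm is attained at `1`. -/
theorem norm_gramForm_le (y : α → F) (x : α → E) (T : E →L[ℂ] E) :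
    ‖gramForm y x T‖ ≤ ‖T‖ * ‖gramForm y x 1‖ := by
  classical
  -- Factoring the Gram matrix of `y` as `Bᴴ B` turns the form into a sum of vector functionals of
  -- the vectors `∑ₐ B r a • x a`, whose positivity is visible.
  obtain ⟨B, hB⟩ : ∃ B : Matrix α α ℂ, Matrix.gram ℂ y = B.conjTranspose * B := by
    open scoped MatrixOrder Matrix.Norms.L2Operator in
    exact CStarAlgebra.nonneg_iff_eq_star_mul_self.mp (Matrix.posSemidef_gram ℂ y).nonneg
  have key : ∀ S : E →L[ℂ] E, gramForm y x S =
      ∑ r, inner ℂ (∑ a, B r a • x a) (S (∑ a, B r a • x a)) := fun S => by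
    have hy : ∀ a b, inner ℂ (y a) (y b) = ∑ r, starRingEnd ℂ (B r a) * B r b := fun a b => by
      rw [← Matrix.gram_apply, hB]
      simp [Matrix.mul_apply]
    simp only [gramForm_apply, hy, map_sum, map_smul, sum_inner, inner_sum, inner_smul_left,
      inner_smul_right, Finset.sum_mul]
    calc _ = ∑ a, ∑ r, ∑ b, starRingEnd ℂ (B r a) * B r b * inner ℂ (x a) (S (x b)) :=
          Finset.sum_congr rfl fun a _ => Finset.sum_comm
      _ = ∑ r, ∑ a, ∑ b, starRingEnd ℂ (B r a) * B r b * inner ℂ (x a) (S (x b)) :=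
          Finset.sum_comm
      _ = _ := by
        refine Finset.sum_congr rfl fun r _ => ?_
        rw [Finset.sum_comm]
        simp only [Finset.mul_sum]
        refine Finset.sum_congr rfl fun a _ => Finset.sum_congr rfl fun b _ => ?_
        ring
  have h1 : ‖gramForm y x 1‖ = ∑ r, ‖∑ a, B r a • x a‖ ^ 2 := by
    have : gramForm y x 1 = ((∑ r, ‖∑ a, B r a • x a‖ ^ 2 : ℝ) : ℂ) := by
      rw [key]
      push_cast
      exact Finset.sum_congr rfl fun r _ => inner_self_eq_norm_sq_to_K _
    rw [this, Complex.norm_real, Real.norm_of_nonneg (by positivity)]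
  rw [h1, key, Finset.mul_sum]
  refine (norm_sum_le _ _).trans (Finset.sum_le_sum fun r _ => ?_)
  refine (norm_inner_le_norm _ _).trans ?_
  calc _ ≤ ‖∑ a, B r a • x a‖ * (‖T‖ * ‖∑ a, B r a • x a‖) := by
        gcongr; exact T.le_opNorm _
    _ = _ := by ring

end GramForm

/-! ### Exchanging legs between two vectors. -/

section CrossForm

variable {ι : Type v} [Fintype ι] {H : ι → Type u}
  [∀ i, NormedAddCommGroup (H i)] [∀ i, InnerProductSpace ℂ (H i)]
  [DecidableEq ι]

/-- Exchanging legs only redistributes the same scalar factors `⟪vᵢ, v'ᵢ⟫` and `⟪wᵢ, w'ᵢ⟫` between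
two products. This is why the mass of `crossForm` does not depend on `S`. -/
theorem inner_mk_piecewise_mul (S : Finset ι) (v v' w w' : ∀ i, H i) :
    (inner ℂ (PreTensor.mk (S.piecewise w v)) (PreTensor.mk (S.piecewise w' v')) *
      inner ℂ (PreTensor.mk (S.piecewise v w)) (PreTensor.mk (S.piecewise v' w')) : ℂ) =
    inner ℂ (PreTensor.mk v) (PreTensor.mk v') * inner ℂ (PreTensor.mk w) (PreTensor.mk w') := by
  simp only [inner_mk, ← Finset.prod_mul_distrib]
  refine Finset.prod_congr rfl fun i _ => ?_
  by_cases h : i ∈ S <;> simp [h, mul_comm]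

/-- The functional that is `∑ₚ dₚ • ⊗ vₚ` on the legs in `S` and `∑ₖ cₖ • ⊗ wₖ` on the other
legs. -/
noncomputable def crossForm {κ κ' : Type*} [Fintype κ] [Fintype κ'] (d : κ → ℂ) (v : κ → ∀ i, H i)
    (c : κ' → ℂ) (w : κ' → ∀ i, H i) (S : Finset ι) :
    (HilbertTensor H →L[ℂ] HilbertTensor H) →ₗ[ℂ] ℂ :=
  gramForm (α := κ × κ') (fun a => PreTensor.mk (S.piecewise (w a.2) (v a.1)))
    (fun a => (d a.1 * c a.2) • (PreTensor.mk (S.piecewise (v a.1) (w a.2)) : HilbertTensor H))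

variable {κ κ' : Type*} [Fintype κ] [Fintype κ'] (d : κ → ℂ) (v : κ → ∀ i, H i)
    (c : κ' → ℂ) (w : κ' → ∀ i, H i)

theorem crossForm_apply (S : Finset ι) (T : HilbertTensor H →L[ℂ] HilbertTensor H) :
    crossForm d v c w S T = ∑ a : κ × κ', ∑ b : κ × κ',
      starRingEnd ℂ (d a.1 * c a.2) * (d b.1 * c b.2) *
      (inner ℂ (PreTensor.mk (S.piecewise (w a.2) (v a.1)))
        (PreTensor.mk (S.piecewise (w b.2) (v b.1))) *
      inner ℂ (PreTensor.mk (S.piecewise (v a.1) (w a.2)) : HilbertTensor H)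
        (T (PreTensor.mk (S.piecewise (v b.1) (w b.2)) : HilbertTensor H))) := by
  simp only [crossForm, gramForm_apply, map_smul, inner_smul_left, inner_smul_right]
  exact Finset.sum_congr rfl fun a _ => Finset.sum_congr rfl fun b _ => by ring

theorem sum_sum_mul_mul {κ κ' : Type*} [Fintype κ] [Fintype κ'] (f : κ → κ → ℂ) (g : κ' → κ' → ℂ) :
    ∑ a : κ × κ', ∑ b : κ × κ', f a.1 b.1 * g a.2 b.2 =
      (∑ p, ∑ q, f p q) * ∑ k, ∑ l, g k l := by
  simp only [Fintype.sum_prod_type, Finset.sum_mul_sum]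

theorem inner_sum_smul_mk (T : HilbertTensor H →L[ℂ] HilbertTensor H) :
    inner ℂ ((∑ k, c k • PreTensor.mk (w k) : PreTensor H) : HilbertTensor H)
      (T ((∑ k, c k • PreTensor.mk (w k) : PreTensor H) : HilbertTensor H)) =
    ∑ k, ∑ l, starRingEnd ℂ (c k) * c l * inner ℂ (PreTensor.mk (w k) : HilbertTensor H)
      (T (PreTensor.mk (w l) : HilbertTensor H)) := by
  have : ((∑ k, c k • PreTensor.mk (w k) : PreTensor H) : HilbertTensor H) =
      ∑ k, c k • (PreTensor.mk (w k) : HilbertTensor H) := by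
    rw [← UniformSpace.Completion.coe_toComplL (𝕜 := ℂ)]
    simp [map_sum]
  rw [this]
  simp only [map_sum, map_smul, sum_inner, inner_sum, inner_smul_left, inner_smul_right]
  rw [Finset.sum_comm]
  simp only [Finset.mul_sum]
  exact Finset.sum_congr rfl fun k _ => Finset.sum_congr rfl fun l _ => by ring

theorem norm_sq_sum_smul_mk :
    ((‖(∑ k, c k • PreTensor.mk (w k) : PreTensor H)‖ ^ 2 : ℝ) : ℂ) =
    ∑ k, ∑ l, starRingEnd ℂ (c k) * c l * inner ℂ (PreTensor.mk (w k)) (PreTensor.mk (w l)) := by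
  have h := inner_sum_smul_mk c w 1
  simp only [one_apply_eq_self, UniformSpace.Completion.inner_coe] at h
  rw [← h]
  push_cast
  exact (inner_self_eq_norm_sq_to_K (𝕜 := ℂ) (∑ k, c k • PreTensor.mk (w k))).symm

theorem crossForm_empty (T : HilbertTensor H →L[ℂ] HilbertTensor H) :
    crossForm d v c w ∅ T = (‖(∑ p, d p • PreTensor.mk (v p) : PreTensor H)‖ ^ 2 : ℝ) *
      inner ℂ ((∑ k, c k • PreTensor.mk (w k) : PreTensor H) : HilbertTensor H)
      (T ((∑ k, c k • PreTensor.mk (w k) : PreTensor H) : HilbertTensor H)) := by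
  rw [norm_sq_sum_smul_mk, inner_sum_smul_mk, ← sum_sum_mul_mul, crossForm_apply]
  refine Finset.sum_congr rfl fun a _ => Finset.sum_congr rfl fun b _ => ?_
  simp only [Finset.piecewise_empty, map_mul]
  ring

theorem crossForm_univ (T : HilbertTensor H →L[ℂ] HilbertTensor H) :
    crossForm d v c w Finset.univ T = (‖(∑ k, c k • PreTensor.mk (w k) : PreTensor H)‖ ^ 2 : ℝ) *
      inner ℂ ((∑ p, d p • PreTensor.mk (v p) : PreTensor H) : HilbertTensor H)
      (T ((∑ p, d p • PreTensor.mk (v p) : PreTensor H) : HilbertTensor H)) := by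
  rw [norm_sq_sum_smul_mk, inner_sum_smul_mk, mul_comm, ← sum_sum_mul_mul, crossForm_apply]
  refine Finset.sum_congr rfl fun a _ => Finset.sum_congr rfl fun b _ => ?_
  simp only [Finset.piecewise_univ, map_mul]
  ring

theorem crossForm_one (S : Finset ι) :
    crossForm d v c w S 1 = ((‖(∑ p, d p • PreTensor.mk (v p) : PreTensor H)‖ ^ 2 *
      ‖(∑ k, c k • PreTensor.mk (w k) : PreTensor H)‖ ^ 2 : ℝ) : ℂ) := by
  rw [Complex.ofReal_mul, norm_sq_sum_smul_mk, norm_sq_sum_smul_mk, ← sum_sum_mul_mul,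
    crossForm_apply]
  refine Finset.sum_congr rfl fun a _ => Finset.sum_congr rfl fun b _ => ?_
  simp only [one_apply_eq_self, UniformSpace.Completion.inner_coe,
    inner_mk_piecewise_mul, map_mul]
  ring

theorem norm_crossForm_le (S : Finset ι) (T : HilbertTensor H →L[ℂ] HilbertTensor H) :
    ‖crossForm d v c w S T‖ ≤ ‖T‖ * (‖(∑ p, d p • PreTensor.mk (v p) : PreTensor H)‖ ^ 2 *
      ‖(∑ k, c k • PreTensor.mk (w k) : PreTensor H)‖ ^ 2) := by
  refine (norm_gramForm_le _ _ T).trans_eq ?_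
  change ‖T‖ * ‖crossForm d v c w S 1‖ = _
  rw [crossForm_one, Complex.norm_real, Real.norm_of_nonneg (by positivity)]

variable [∀ i, CompleteSpace (H i)]

theorem leg_mk (j : ι) (T : H j →L[ℂ] H j) (x : ∀ i, H i) :
    leg j T (PreTensor.mk x : HilbertTensor H) =
      (PreTensor.mk (Function.update x j (T (x j))) : HilbertTensor H) := by
  rw [leg_apply_coe, legPre_mk]

/-- Elementary tensors span a dense subspace. -/
theorem ext_mk {S T : HilbertTensor H →L[ℂ] HilbertTensor H}
    (h : ∀ x : ∀ i, H i, S (PreTensor.mk x : HilbertTensor H) = T (PreTensor.mk x : HilbertTensor H)) :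
    S = T := by
  ext x
  induction x using UniformSpace.Completion.induction_on with
  | hp => exact isClosed_eq S.continuous T.continuous
  | ih x =>
    obtain ⟨m, c, w, rfl⟩ := PreTensor.exists_sum x
    rw [← UniformSpace.Completion.coe_toComplL (𝕜 := ℂ)]
    simp [map_sum, h]

theorem commute_leg {i j : ι} (hij : i ≠ j) (R : H i →L[ℂ] H i) (T : H j →L[ℂ] H j) :
    Commute (leg i R) (leg j T) := by
  refine ext_mk fun x => ?_
  simp only [mul_apply_eq_comp, leg_mk]
  rw [Function.update_of_ne hij, Function.update_of_ne hij.symm, Function.update_comm hij]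

/-- An operator commuting with all of `B(H i)` acts as a scalar on leg `i`, so its matrix
coefficients see that leg only through `⟪x i, x' i⟫`. The cross-multiplied form needs no nonzero
vector in `H i`. -/
theorem inner_mul_inner_of_commute_leg {i : ι} {T : HilbertTensor H →L[ℂ] HilbertTensor H}
    (hT : ∀ R : H i →L[ℂ] H i, Commute (leg i R) T) (x x' : ∀ i, H i) (b b' : H i) :
    inner ℂ b b' * inner ℂ (PreTensor.mk x : HilbertTensor H) (T (PreTensor.mk x')) =
      inner ℂ (x i) (x' i) * inner ℂ (PreTensor.mk (Function.update x i b) : HilbertTensor H)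
        (T (PreTensor.mk (Function.update x' i b'))) := by
  have hmk : ∀ (z : ∀ i, H i) (r : ℂ) (e : H i), PreTensor.mk (Function.update z i (r • e)) =
      r • PreTensor.mk (Function.update z i e) := fun z r e =>
    (PiTensorProduct.tprod ℂ).map_update_smul z i r e
  -- The rank-one operator `b' ⟪x i, ·⟫` puts `b'` in leg `i` of `x'`, with the factor `⟪x i, x'
  -- i⟫`; its adjoint puts `x i` back in place of `b`. Moving it across `T` gives the identity.
  have h1 := leg_mk i (InnerProductSpace.rankOne ℂ b' (x i)) x'
  have h2 := leg_mk i (InnerProductSpace.rankOne ℂ (x i) b') (Function.update x i b)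
  have h3 : leg i (InnerProductSpace.rankOne ℂ (x i) b') =
      ContinuousLinearMap.adjoint (leg i (InnerProductSpace.rankOne ℂ b' (x i))) := by
    rw [← ContinuousLinearMap.star_eq_adjoint, ← map_star, ContinuousLinearMap.star_eq_adjoint,
      InnerProductSpace.adjoint_rankOne]
  have h4 := DFunLike.congr_fun (hT (InnerProductSpace.rankOne ℂ b' (x i))).eq
    (PreTensor.mk x' : HilbertTensor H)
  simp only [mul_apply_eq_comp] at h4
  rw [h1] at h4
  rw [h3] at h2
  have h5 := ContinuousLinearMap.adjoint_inner_left (leg i (InnerProductSpace.rankOne ℂ b' (x i)))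
    (T (PreTensor.mk x')) (PreTensor.mk (Function.update x i b))
  rw [h4, h2] at h5
  simpa [hmk, UniformSpace.Completion.coe_smul, inner_smul_left, inner_smul_right] using h5

/-- Exchanging leg `i` trades the factor `⟪·, ·⟫` of one copy for that of the other; for an operator
that is scalar on this leg, each summand already contains both factors. -/
theorem crossForm_insert {i : ι} {S : Finset ι} (hi : i ∉ S)
    {T : HilbertTensor H →L[ℂ] HilbertTensor H} (hT : ∀ R : H i →L[ℂ] H i, Commute (leg i R) T) :
    crossForm d v c w (insert i S) T = crossForm d v c w S T := by
  rw [crossForm_apply, crossForm_apply]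
  refine Finset.sum_congr rfl fun a _ => Finset.sum_congr rfl fun b _ => ?_
  congr 1
  rw [inner_mk, inner_mk, ← Finset.mul_prod_erase Finset.univ _ (Finset.mem_univ i),
    ← Finset.mul_prod_erase Finset.univ (fun j => inner ℂ (S.piecewise (w a.2) (v a.1) j) _)
      (Finset.mem_univ i)]
  have h := inner_mul_inner_of_commute_leg hT (S.piecewise (v a.1) (w a.2))
    (S.piecewise (v b.1) (w b.2)) (v a.1 i) (v b.1 i)
  have hp : ∏ j ∈ Finset.univ.erase i, inner ℂ ((insert i S).piecewise (w a.2) (v a.1) j)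
      ((insert i S).piecewise (w b.2) (v b.1) j) =
      ∏ j ∈ Finset.univ.erase i, inner ℂ (S.piecewise (w a.2) (v a.1) j)
      (S.piecewise (w b.2) (v b.1) j) :=
    Finset.prod_congr rfl fun j hj => by
      simp only [Finset.piecewise, Finset.mem_insert, Finset.ne_of_mem_erase hj, false_or]
  rw [hp]
  simp only [Finset.piecewise_insert, Function.update_self, Finset.piecewise_eq_of_notMem _ _ _ hi] at h ⊢
  linear_combination (-∏ j ∈ Finset.univ.erase i, inner ℂ (S.piecewise (w a.2) (v a.1) j)
      (S.piecewise (w b.2) (v b.1) j)) * h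

end CrossForm

/-! ### From the numerical range to the distance from the scalars. -/

section NumericalRange

variable {E : Type*} [NormedAddCommGroup E] [InnerProductSpace ℂ E] [CompleteSpace E]

/-- The norm of a self-adjoint operator is the supremum of the absolute values of its Rayleigh
quotients. The hypothesis confines these quotients to an interval of length `D`, so subtracting the
midpoint leaves at most `D / 2`. The homogeneous form of the hypothesis avoids normalising and
passes to limits of vectors. -/
theorem exists_norm_sub_smul_one_le {T : E →L[ℂ] E} (hT : IsSelfAdjoint T) {D : ℝ} (hD : 0 ≤ D)
    (h : ∀ x y : E, ‖((‖y‖ ^ 2 : ℝ) : ℂ) * inner ℂ x (T x) - ((‖x‖ ^ 2 : ℝ) : ℂ) * inner ℂ y (T y)‖ ≤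
      D * (‖y‖ ^ 2 * ‖x‖ ^ 2)) :
    ∃ z : ℂ, ‖T - z • 1‖ ≤ D / 2 := by
  rcases subsingleton_or_nontrivial E with hE | hE
  · exact ⟨0, by rw [Subsingleton.elim (T - (0 : ℂ) • 1) 0, norm_zero]; positivity⟩
  have hR : ∀ x y : E, x ≠ 0 → y ≠ 0 → T.rayleighQuotient x ≤ T.rayleighQuotient y + D := by
    intro x y hx hy
    have hx' : 0 < ‖x‖ ^ 2 := by positivity
    have hy' : 0 < ‖y‖ ^ 2 := by positivity
    have h1 := (Complex.re_le_norm _).trans (h x y)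
    simp only [Complex.sub_re, Complex.re_ofReal_mul] at h1
    have e : ∀ x, T.reApplyInnerSelf x = (inner ℂ x (T x)).re := fun x => by
      rw [ContinuousLinearMap.reApplyInnerSelf_apply, ← inner_re_symm]; rfl
    simp only [ContinuousLinearMap.rayleighQuotient, e]
    rw [div_add' _ _ _ hy'.ne', div_le_div_iff₀ hx' hy']
    nlinarith
  set W := T.rayleighQuotient '' {x | x ≠ 0} with hW
  have hne : W.Nonempty := by
    obtain ⟨x, hx⟩ := exists_ne (0 : E)
    exact ⟨_, x, hx, rfl⟩
  have hdiff : ∀ a ∈ W, ∀ b ∈ W, a ≤ b + D := by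
    rintro _ ⟨x, hx, rfl⟩ _ ⟨y, hy, rfl⟩
    exact hR x y hx hy
  obtain ⟨w, hw⟩ := hne
  have hba : BddAbove W := ⟨w + D, fun a ha => hdiff a ha w hw⟩
  have hbb : BddBelow W := ⟨w - D, fun a ha => by linarith [hdiff w hw a ha]⟩
  have hMm : sSup W ≤ sInf W + D := by
    refine csSup_le ⟨w, hw⟩ fun a ha => ?_
    have : a - D ≤ sInf W := le_csInf ⟨w, hw⟩ fun b hb => by linarith [hdiff a ha b hb]
    linarith
  set t : ℝ := (sSup W + sInf W) / 2
  refine ⟨(t : ℂ), ?_⟩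
  have hsa : IsSelfAdjoint (T - (t : ℂ) • 1) := by
    refine hT.sub (IsSelfAdjoint.smul ?_ (.one _))
    simp [IsSelfAdjoint]
  rw [ContinuousLinearMap.norm_eq_iSup_rayleighQuotient _
    (ContinuousLinearMap.isSelfAdjoint_iff_isSymmetric.mp hsa)]
  refine ciSup_le fun x => ?_
  by_cases hx : x = 0
  · simp only [hx, ContinuousLinearMap.rayleighQuotient_apply_zero, abs_zero]; positivity
  have hx' : ‖x‖ ^ 2 ≠ 0 := by positivity
  have : (T - (t : ℂ) • 1).rayleighQuotient x = T.rayleighQuotient x - t := by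
    simp only [ContinuousLinearMap.rayleighQuotient, ContinuousLinearMap.reApplyInnerSelf_apply]
    rw [div_sub' hx', ← inner_self_eq_norm_sq (𝕜 := ℂ)]
    simp [inner_sub_left, mul_comm]
  rw [this, abs_le]
  have h1 := le_csSup hba ⟨x, hx, rfl⟩
  have h2 := csInf_le hbb ⟨x, hx, rfl⟩
  constructor <;> simp only [t] <;> linarith

end NumericalRange

/-! ### The upper bound for self-adjoint elements. -/

section Upper

variable {ι : Type v} [Fintype ι] [DecidableEq ι] {A : ι → Type u} [∀ i, CStarAlgebra (A i)]

/-- Different legs commute, and a centralizer is a closed star-subalgebra, so commutation extends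
from the generators to their closed span. -/
theorem commute_leg_of_mem_compl {i : ι} {c : MinTensor A} (hc : c ∈ MinTensor.compl A i)
    (R : UniversalSpace (A i) →L[ℂ] UniversalSpace (A i)) :
    Commute (leg (H := fun i => UniversalSpace (A i)) i R) c.1 := by
  let Z : StarSubalgebra ℂ (MinTensor A) := (StarSubalgebra.centralizer ℂ
    (Set.range (leg (H := fun i => UniversalSpace (A i)) i))).comap (minTensorSubalgebra A).subtype
  have hZ : MinTensor.compl A i ≤ Z := by
    refine StarSubalgebra.topologicalClosure_minimal (StarAlgebra.adjoin_le ?_) ?_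
    · intro x hx
      simp only [Set.mem_iUnion] at hx
      obtain ⟨j, hj, a, rfl⟩ := hx
      refine (StarSubalgebra.mem_centralizer_iff ℂ).mpr ?_
      rintro _ ⟨S, rfl⟩
      have hij : i ≠ j := fun h => hj h.symm
      refine ⟨(commute_leg (H := fun i => UniversalSpace (A i)) hij S (universalRep (A j) a)).eq, ?_⟩
      rw [← map_star]
      exact (commute_leg (H := fun i => UniversalSpace (A i)) hij _ (universalRep (A j) a)).eq
    · exact (Set.isClosed_centralizer _).preimage continuous_subtype_val
  have := (StarSubalgebra.mem_centralizer_iff ℂ).mp (hZ hc)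
  exact (this _ ⟨R, rfl⟩).1

theorem partialSeminorm_nonneg (i : ι) (a : MinTensor A) : 0 ≤ partialSeminorm A i a :=
  mul_nonneg zero_le_two (Real.iInf_nonneg fun _ => norm_nonneg _)

theorem partialSeminorm_le (i : ι) (a : MinTensor A) {c : MinTensor A}
    (hc : c ∈ MinTensor.compl A i) : partialSeminorm A i a ≤ 2 * ‖a - c‖ :=
  mul_le_mul_of_nonneg_left
    (ciInf_le (f := fun c : MinTensor.compl A i => ‖a - (c : MinTensor A)‖)
      ⟨0, by rintro _ ⟨x, rfl⟩; positivity⟩ ⟨c, hc⟩) zero_le_two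

theorem le_partialSeminorm {i : ι} {a : MinTensor A} {r : ℝ}
    (h : ∀ c ∈ MinTensor.compl A i, r ≤ 2 * ‖a - c‖) : r ≤ partialSeminorm A i a := by
  have : Nonempty (MinTensor.compl A i) := ⟨0⟩
  have : r / 2 ≤ ⨅ c : MinTensor.compl A i, ‖a - (c : MinTensor A)‖ :=
    le_ciInf fun c => by linarith [h c c.2]
  rw [partialSeminorm]
  linarith

theorem partialSeminorm_le_quantumHamming (i : ι) (a : MinTensor A) :
    partialSeminorm A i a ≤ quantumHamming A a :=
  le_ciSup (f := fun i => partialSeminorm A i a) (Set.finite_range _).bddAbove i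

theorem quantumHamming_nonneg (a : MinTensor A) : 0 ≤ quantumHamming A a :=
  Real.iSup_nonneg fun i => partialSeminorm_nonneg i a

theorem quantumHamming_le {a : MinTensor A} {r : ℝ} (hr : 0 ≤ r)
    (h : ∀ i, partialSeminorm A i a ≤ r) : quantumHamming A a ≤ r :=
  Real.iSup_le h hr

theorem sum_partialSeminorm_le (a : MinTensor A) :
    ∑ i, partialSeminorm A i a ≤ Fintype.card ι * quantumHamming A a := by
  refine (Finset.sum_le_card_nsmul _ _ _ fun i _ => partialSeminorm_le_quantumHamming i a).trans_eq ?_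
  rw [nsmul_eq_mul]; rfl

/-- The subalgebras `⊗_{j ≠ i} A j` are stable under `c ↦ Re (u c)`, and this map is contractive. -/
theorem quantumHamming_realPart_smul_le {u : ℂ} (hu : ‖u‖ = 1) (a : MinTensor A) :
    quantumHamming A (realPart (u • a) : MinTensor A) ≤ quantumHamming A a := by
  refine quantumHamming_le (quantumHamming_nonneg a) fun i =>
    le_trans (le_partialSeminorm fun c hc => ?_) (partialSeminorm_le_quantumHamming i a)
  have hc' : (realPart (u • c) : MinTensor A) ∈ MinTensor.compl A i := by
    rw [realPart_apply_coe, ← Complex.coe_smul]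
    exact (MinTensor.compl A i).smul_mem (add_mem ((MinTensor.compl A i).smul_mem hc _)
      (star_mem ((MinTensor.compl A i).smul_mem hc _))) _
  refine (partialSeminorm_le i _ hc').trans (mul_le_mul_of_nonneg_left ?_ zero_le_two)
  rw [← AddSubgroupClass.coe_sub, ← map_sub, ← smul_sub]
  refine (realPart.norm_le (u • (a - c))).trans_eq ?_
  rw [norm_smul, hu, one_mul]

theorem norm_inner_sub_inner_le (a : MinTensor A)
    (x y : HilbertTensor (fun i => UniversalSpace (A i))) :
    ‖((‖y‖ ^ 2 : ℝ) : ℂ) * inner ℂ x (a.1 x) - ((‖x‖ ^ 2 : ℝ) : ℂ) * inner ℂ y (a.1 y)‖ ≤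
      (∑ i, partialSeminorm A i a) * (‖y‖ ^ 2 * ‖x‖ ^ 2) := by
  induction x, y using UniformSpace.Completion.induction_on₂ with
  | hp => apply isClosed_le <;> fun_prop
  | ih x y =>
    obtain ⟨m, c, w, rfl⟩ := PreTensor.exists_sum x
    obtain ⟨m', d, v, rfl⟩ := PreTensor.exists_sum y
    have key : ∀ S : Finset ι, ‖crossForm d v c w ∅ a.1 - crossForm d v c w S a.1‖ ≤
        (∑ i ∈ S, partialSeminorm A i a) *
          (‖(∑ p, d p • PreTensor.mk (v p) : PreTensor fun i => UniversalSpace (A i))‖ ^ 2 *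
          ‖(∑ k, c k • PreTensor.mk (w k) : PreTensor fun i => UniversalSpace (A i))‖ ^ 2) := by
      intro S
      induction S using Finset.induction_on with
      | empty => simp
      | insert i S hi ih =>
        rw [Finset.sum_insert hi, add_mul, add_comm]
        refine (norm_sub_le_norm_sub_add_norm_sub _ (crossForm d v c w S a.1) _).trans
          (add_le_add ih ?_)
        set K : ℝ := ‖(∑ p, d p • PreTensor.mk (v p) : PreTensor fun i => UniversalSpace (A i))‖ ^ 2 *
          ‖(∑ k, c k • PreTensor.mk (w k) : PreTensor fun i => UniversalSpace (A i))‖ ^ 2 with hK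
        have hb : ∀ b ∈ MinTensor.compl A i,
            ‖crossForm d v c w S a.1 - crossForm d v c w (insert i S) a.1‖ ≤ 2 * ‖a - b‖ * K := by
          intro b hb
          have e := crossForm_insert d v c w hi (commute_leg_of_mem_compl hb)
          -- The two functionals agree at `b`, so `a` may be replaced by `a - b` in their
          -- difference.
          have : crossForm d v c w S a.1 - crossForm d v c w (insert i S) a.1 =
              crossForm d v c w S (a - b).1 - crossForm d v c w (insert i S) (a - b).1 := by
            rw [AddSubgroupClass.coe_sub, map_sub, map_sub, e]; ring
          rw [this]
          have h1 := norm_crossForm_le d v c w S (a - b).1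
          have h2 := norm_crossForm_le d v c w (insert i S) (a - b).1
          rw [← hK] at h1 h2
          have h3 : ‖a - b‖ = ‖(a - b).1‖ := rfl
          rw [h3]
          linarith [norm_sub_le (crossForm d v c w S (a - b).1)
            (crossForm d v c w (insert i S) (a - b).1)]
        have hK0 : 0 ≤ K := by positivity
        -- For `K = 0` one cannot divide by `K` to pass to the infimum over `b`, but then `b = 0`
        -- already gives the bound.
        rcases hK0.eq_or_lt with h0 | h0
        · have := hb 0 (zero_mem _)
          rwa [← h0, mul_zero] at this ⊢
        · rw [← div_le_iff₀ h0]
          exact le_partialSeminorm fun b hb' => (div_le_iff₀ h0).mpr (hb b hb')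
    have := key Finset.univ
    rw [crossForm_empty, crossForm_univ] at this
    rwa [UniformSpace.Completion.norm_coe, UniformSpace.Completion.norm_coe]

theorem exists_norm_sub_smul_one_le_quantumHamming {a : MinTensor A} (ha : IsSelfAdjoint a) :
    ∃ z : ℂ, ‖a - z • 1‖ ≤ Fintype.card ι / 2 * quantumHamming A a := by
  have hsa : IsSelfAdjoint a.1 := congrArg Subtype.val ha
  obtain ⟨z, hz⟩ := exists_norm_sub_smul_one_le hsa
    (mul_nonneg (Nat.cast_nonneg (Fintype.card ι)) (quantumHamming_nonneg a)) fun x y =>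
      (norm_inner_sub_inner_le a x y).trans
        (mul_le_mul_of_nonneg_right (sum_partialSeminorm_le a) (by positivity))
  exact ⟨z, hz.trans_eq (by ring)⟩

end Upper

/-! ### States: normalisation, vector representation and values on the spectrum. -/

section States

variable {A : Type u} [CStarAlgebra A]

attribute [local instance] CStarAlgebra.spectralOrder CStarAlgebra.spectralOrderedRing

theorem State.toPositive_apply (φ : State A) (x : A) : φ.toPositive x = φ x := rfl

theorem State.map_star (φ : State A) (x : A) : φ (star x) = starRingEnd ℂ (φ x) :=
  StarHomClass.map_star φ.toPositive x

theorem State.nontrivial (φ : State A) : Nontrivial A := by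
  by_contra h
  rw [not_nontrivial_iff_subsingleton] at h
  have := φ.norm_eq_one
  rw [Subsingleton.elim φ.toCLM 0, norm_zero] at this
  exact zero_ne_one this

/-- Cauchy–Schwarz for the GNS inner product gives `|φ x|² ≤ φ 1 * φ (x⋆ x) ≤ (φ 1)² ‖x‖²`, hence
`‖φ‖ ≤ φ 1`. -/
theorem State.map_one (φ : State A) : φ 1 = 1 := by
  have := φ.nontrivial
  have h0 : 0 ≤ φ 1 := by simpa using φ.nonneg 1
  have hle : ‖φ 1‖ ≤ 1 := by
    simpa [φ.norm_eq_one] using φ.toCLM.le_opNorm 1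
  have hge : ‖φ.toCLM‖ ≤ ‖φ 1‖ := by
    refine ContinuousLinearMap.opNorm_le_bound _ (norm_nonneg _) fun x => ?_
    have h1 : ‖φ x‖ ≤ ‖φ.toPositive.toPreGNS 1‖ * ‖φ.toPositive.toPreGNS x‖ := by
      have := norm_inner_le_norm (𝕜 := ℂ) (φ.toPositive.toPreGNS 1) (φ.toPositive.toPreGNS x)
      rwa [PositiveLinearMap.preGNS_inner_def, PositiveLinearMap.ofPreGNS_toPreGNS,
        PositiveLinearMap.ofPreGNS_toPreGNS, star_one, one_mul] at this
    have h2 : ∀ y, ‖φ.toPositive.toPreGNS y‖ ^ 2 ≤ ‖φ 1‖ * ‖y‖ ^ 2 := fun y => by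
      have e := congrArg norm (φ.toPositive.preGNS_norm_sq (φ.toPositive.toPreGNS y))
      rw [PositiveLinearMap.ofPreGNS_toPreGNS] at e
      have := φ.toPositive.norm_apply_le_of_nonneg _ (star_mul_self_nonneg y)
      rw [← e, CStarRing.norm_star_mul_self, ← sq] at this
      simpa [State.toPositive_apply] using this
    have h3 := h2 1
    rw [CStarRing.norm_one] at h3
    refine h1.trans ((sq_le_sq₀ (by positivity) (by positivity)).mp ?_)
    rw [mul_pow, mul_pow, sq ‖φ 1‖]
    calc _ ≤ (‖φ 1‖ * 1 ^ 2) * (‖φ 1‖ * ‖x‖ ^ 2) := by gcongr; exact h2 x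
      _ = _ := by ring
  rw [φ.norm_eq_one] at hge
  have h1 : ‖φ 1‖ = 1 := le_antisymm hle hge
  rw [← Complex.norm_of_nonneg' h0, h1, Complex.ofReal_one]

/-- A phase `u` makes the difference of the two values real and nonnegative, so it survives passing
to the real part; the scalar `z` cancels because both states map `1` to `1`. -/
theorem State.exists_norm_sub_le (μ ν : State A) (a : A) :
    ∃ u : ℂ, ‖u‖ = 1 ∧ ∀ z : ℂ, ‖μ a - ν a‖ ≤ 2 * ‖(realPart (u • a) : A) - z • 1‖ := by
  obtain ⟨u, hu, hu'⟩ : ∃ u : ℂ, ‖u‖ = 1 ∧ u * (μ a - ν a) = ‖μ a - ν a‖ := by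
    by_cases h0 : μ a - ν a = 0
    · exact ⟨1, by simp, by simp [h0]⟩
    · have h0' : (‖μ a - ν a‖ : ℂ) ≠ 0 := by simpa using h0
      refine ⟨‖μ a - ν a‖ / (μ a - ν a), ?_, div_mul_cancel₀ _ h0⟩
      rw [norm_div, Complex.norm_real, norm_norm, div_self (norm_ne_zero_iff.mpr h0)]
  set b : A := (realPart (u • a) : A) with hb
  refine ⟨u, hu, fun z => ?_⟩
  set b : A := (realPart (u • a) : A) with hb
  have hre : ∀ φ : State A, φ b = ((u * φ a).re : ℂ) := fun φ => by
    rw [hb, realPart_apply_coe, ← Complex.coe_smul, map_smul, map_add, φ.map_star, map_smul,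
      smul_eq_mul, smul_eq_mul, Complex.add_conj]
    push_cast; ring
  have hdiff : μ (b - z • (1 : A)) - ν (b - z • (1 : A)) = (‖μ a - ν a‖ : ℂ) := by
    rw [map_sub, map_sub, map_smul, map_smul, μ.map_one, ν.map_one, hre, hre, sub_sub_sub_cancel_right,
      ← Complex.ofReal_sub, ← Complex.sub_re, ← mul_sub, hu', Complex.ofReal_re]
  have hφ : ∀ φ : State A, ‖φ (b - z • (1 : A))‖ ≤ ‖b - z • (1 : A)‖ := fun φ => by
    simpa [φ.norm_eq_one] using φ.toCLM.le_opNorm (b - z • (1 : A))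
  have := norm_sub_le (μ (b - z • (1 : A))) (ν (b - z • (1 : A)))
  rw [hdiff, Complex.norm_real, norm_norm] at this
  linarith [hφ μ, hφ ν]

/-- The cyclic vector of the GNS representation of a state, in the universal representation. -/
noncomputable def State.vector (φ : State A) : UniversalSpace A :=
  have := Classical.decEq (State A)
  lp.single 2 φ (φ.toPositive.toPreGNS 1 : φ.GNS)

/-- Every state is a vector state in the universal representation; product states can therefore be
built from elementary tensors. -/
theorem State.inner_vector (φ : State A) (x : A) :
    inner ℂ φ.vector (universalRep A x φ.vector) = φ x := by
  classical
  have h : (φ.vector : UniversalSpace A) = lp.single 2 φ (φ.toPositive.toPreGNS 1 : φ.GNS) := by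
    unfold State.vector; congr!
  have h2 : (universalRep A x φ.vector) φ = ((φ.toPositive.toPreGNS x : φ.toPositive.PreGNS) : φ.GNS) := by
    change φ.rep x (φ.vector φ) = _
    rw [h, lp.single_apply_self]
    change φ.toPositive.gnsNonUnitalStarAlgHom x _ = _
    rw [PositiveLinearMap.gnsNonUnitalStarAlgHom_apply_coe]
    simp
  nth_rewrite 1 [h]
  rw [lp.inner_single_left, h2, UniformSpace.Completion.inner_coe,
    PositiveLinearMap.preGNS_inner_def]
  simp [State.toPositive_apply]

theorem State.norm_vector (φ : State A) : ‖φ.vector‖ = 1 := by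
  have h := φ.inner_vector 1
  rw [_root_.map_one, one_apply_eq_self, φ.map_one, inner_self_eq_norm_sq_to_K] at h
  have : ‖φ.vector‖ ^ 2 = 1 := Complex.ofReal_injective (by push_cast; exact h)
  nlinarith [norm_nonneg φ.vector]

/-- A functional of norm at most one that maps `1` to `1` is positive on positive elements. -/
theorem nonneg_of_norm_le_one {f : A →L[ℂ] ℂ} (hf : ‖f‖ ≤ 1) (h1 : f 1 = 1) {b : A}
    (hb : 0 ≤ b) : 0 ≤ f b := by
  have : Nontrivial A := by
    by_contra h
    rw [not_nontrivial_iff_subsingleton] at h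
    rw [Subsingleton.elim (1 : A) 0, map_zero] at h1
    exact zero_ne_one h1
  have hsa : IsSelfAdjoint b := .of_nonneg hb
  have him : (f b).im = 0 := by
    by_contra him
    -- Shifting by `i t` adds `t²` to the bound on the squared norm, but `2 t Im (f b) + t²` to the
    -- squared imaginary part. This `t` makes the linear term equal to `‖b‖²`, a contradiction.
    obtain ⟨t, ht⟩ : ∃ t : ℝ, ‖b‖ ^ 2 < (f b).im ^ 2 + 2 * t * (f b).im := by
      refine ⟨‖b‖ ^ 2 / (2 * (f b).im), ?_⟩
      have : 2 * (‖b‖ ^ 2 / (2 * (f b).im)) * (f b).im = ‖b‖ ^ 2 := by field_simp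
      rw [this]
      have : 0 < (f b).im ^ 2 := by positivity
      linarith
    set g : A := b + (Complex.I * t) • 1 with hg
    have hn : ‖g‖ ^ 2 ≤ ‖b‖ ^ 2 + t ^ 2 := by
      have : star g * g = star b * b + ((t ^ 2 : ℝ) : ℂ) • 1 := by
        have e : -Complex.I * t * (Complex.I * t) = ((t ^ 2 : ℝ) : ℂ) := by
          push_cast; linear_combination (-t ^ 2 : ℂ) * Complex.I_sq
        simp only [hg, star_add, star_smul, star_one, hsa.star_eq, add_mul, mul_add, smul_mul_assoc,
          mul_smul_comm, one_mul, mul_one, RCLike.star_def, map_mul, Complex.conj_I,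
          Complex.conj_ofReal]
        rw [← e]
        module
      rw [sq, ← CStarRing.norm_star_mul_self, this]
      refine (norm_add_le _ _).trans ?_
      rw [CStarRing.norm_star_mul_self, norm_smul, CStarRing.norm_one, Complex.norm_real,
        Real.norm_of_nonneg (by positivity)]
      nlinarith
    have h2 : ‖f g‖ ^ 2 ≤ ‖g‖ ^ 2 := by
      gcongr
      exact (f.le_opNorm g).trans (mul_le_of_le_one_left (norm_nonneg _) hf)
    have h3 : ((f b).im + t) ^ 2 ≤ ‖f g‖ ^ 2 := by
      have : (f g).im = (f b).im + t := by simp [hg, h1]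
      rw [← this, ← Complex.normSq_eq_norm_sq, Complex.normSq_apply]
      nlinarith [mul_self_nonneg (f g).re]
    nlinarith
  refine Complex.nonneg_iff.mpr ⟨?_, him.symm⟩
  -- Positivity of the real part comes from `0 ≤ ‖b‖ - b ≤ ‖b‖`: the value `‖b‖ - f b` has modulus
  -- at most `‖b‖`.
  have h2 : ‖(‖b‖ : ℂ) • (1 : A) - b‖ ≤ ‖b‖ := by
    have h3 : b ≤ algebraMap ℝ A ‖b‖ := IsSelfAdjoint.le_algebraMap_norm_self hsa
    have e : (‖b‖ : ℂ) • (1 : A) = algebraMap ℝ A ‖b‖ := by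
      rw [Algebra.algebraMap_eq_smul_one, Complex.coe_smul]
    rw [e]
    refine (CStarAlgebra.norm_le_norm_of_nonneg_of_le (sub_nonneg.mpr h3)
      (sub_le_self _ hb)).trans ?_
    rw [norm_algebraMap', Real.norm_of_nonneg (norm_nonneg _)]
  have h3 : ‖f ((‖b‖ : ℂ) • (1 : A) - b)‖ ≤ ‖b‖ :=
    ((f.le_opNorm _).trans (mul_le_of_le_one_left (norm_nonneg _) hf)).trans h2
  have h4 := (Complex.re_le_norm _).trans h3
  simp [h1] at h4
  exact h4

/-- On the span of `1` and `h`, the rule `x + y h ↦ x + y l` is contractive because `x + y l` lies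
in the spectrum of `x + y h`. A Hahn–Banach extension has norm one and value `1` at `1`, hence is a
state. -/
theorem exists_state_apply_eq [Nontrivial A] (h : A) {l : ℂ} (hl : l ∈ spectrum ℂ h) :
    ∃ φ : State A, φ h = l := by
  have hspec : ∀ x y : ℂ, ‖x + y * l‖ ≤ ‖x • (1 : A) + y • h‖ := by
    intro x y
    refine spectrum.norm_le_norm_of_mem ?_
    have h1 : y * l ∈ spectrum ℂ (y • h) := by
      by_cases hy : y = 0
      · subst hy; simp
      · have := spectrum.unit_smul_eq_smul h (Units.mk0 y hy)
        rw [show y • h = Units.mk0 y hy • h from rfl, this]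
        exact ⟨l, hl, rfl⟩
    have h2 := spectrum.vadd_eq (R := ℂ) (y • h) x
    rw [← Algebra.algebraMap_eq_smul_one, ← h2]
    exact ⟨y * l, h1, rfl⟩
  let p : Submodule ℂ A := Submodule.span ℂ {1, h}
  have hp : ∀ z : p, ∃ xy : ℂ × ℂ, xy.1 • (1 : A) + xy.2 • h = z := fun z => by
    obtain ⟨x, y, e⟩ := Submodule.mem_span_pair.mp z.2
    exact ⟨(x, y), e⟩
  choose xy hxy using hp
  -- Well-definedness needs an argument since `1` and `h` may be linearly dependent; it follows from
  -- the same norm estimate.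
  have huniq : ∀ (x y x' y' : ℂ), x • (1 : A) + y • h = x' • (1 : A) + y' • h →
      x + y * l = x' + y' * l := by
    intro x y x' y' e
    have := hspec (x - x') (y - y')
    rw [show (x - x') • (1 : A) + (y - y') • h = (x • (1 : A) + y • h) - (x' • (1 : A) + y' • h) by
      module, e, sub_self, norm_zero] at this
    have := norm_le_zero_iff.mp this
    linear_combination this
  let f₀ : p →ₗ[ℂ] ℂ :=
    { toFun := fun z => (xy z).1 + (xy z).2 * l
      map_add' := fun z z' => by
        have := huniq (xy (z + z')).1 (xy (z + z')).2 ((xy z).1 + (xy z').1)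
          ((xy z).2 + (xy z').2) (by
            rw [hxy, Submodule.coe_add, ← hxy z, ← hxy z']; module)
        rw [this]; ring
      map_smul' := fun c z => by
        have := huniq (xy (c • z)).1 (xy (c • z)).2 (c * (xy z).1) (c * (xy z).2) (by
            rw [hxy, Submodule.coe_smul, ← hxy z]; module)
        rw [this]; simp only [RingHom.id_apply, smul_eq_mul]; ring }
  let f₁ : p →L[ℂ] ℂ := f₀.mkContinuous 1 fun z => by
    rw [one_mul]
    exact (hspec _ _).trans_eq (congrArg norm (hxy z))
  have hf₁ : ‖f₁‖ ≤ 1 := LinearMap.mkContinuous_norm_le _ zero_le_one _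
  obtain ⟨g, hg, hgn⟩ := exists_extension_norm_eq p f₁
  have h1mem : (1 : A) ∈ p := Submodule.subset_span (by simp)
  have hmem : h ∈ p := Submodule.subset_span (by simp)
  have g1 : g 1 = 1 := by
    have := huniq _ _ 1 0 ((hxy ⟨1, h1mem⟩).trans (by simp))
    exact (hg ⟨1, h1mem⟩).trans (this.trans (by simp))
  have gh : g h = l := by
    have := huniq _ _ 0 1 ((hxy ⟨h, hmem⟩).trans (by simp))
    exact (hg ⟨h, hmem⟩).trans (this.trans (by simp))
  have hgle : ‖g‖ ≤ 1 := hgn.trans_le hf₁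
  refine ⟨⟨g, fun a => nonneg_of_norm_le_one hgle g1 (star_mul_self_nonneg a),
    le_antisymm hgle ?_⟩, gh⟩
  have := g.le_opNorm 1
  rwa [g1, CStarRing.norm_one, norm_one, mul_one] at this

/-- If every self-adjoint element were a scalar, the algebra would be one-dimensional. Otherwise
take a non-scalar one, states attaining the two ends of its spectrum, and rescale the spectrum to
length one. -/
theorem exists_isSelfAdjoint_states [Nontrivial A] (hA : Module.rank ℂ A ≠ 1) :
    ∃ (h : A) (z : ℂ) (φ ψ : State A), ‖h - z • 1‖ ≤ 1 / 2 ∧ φ h - ψ h = 1 := by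
  obtain ⟨h, hsa, hns⟩ : ∃ h : A, IsSelfAdjoint h ∧ ∀ z : ℂ, z • (1 : A) ≠ h := by
    by_contra! H
    refine hA (rank_eq_one (1 : A) one_ne_zero fun w => ?_)
    obtain ⟨r, hr⟩ := H _ (realPart w).2
    obtain ⟨s, hs⟩ := H _ (imaginaryPart w).2
    refine ⟨r + Complex.I * s, ?_⟩
    rw [add_smul, mul_smul, hr, hs]
    exact realPart_add_I_smul_imaginaryPart w
  set σ : Set ℝ := Complex.re '' spectrum ℂ h with hσ
  have hcomp : IsCompact σ := (spectrum.isCompact h).image Complex.continuous_re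
  have hne : σ.Nonempty := (spectrum.nonempty h).image _
  have hmem : ∀ t ∈ σ, (t : ℂ) ∈ spectrum ℂ h := by
    rintro _ ⟨l, hl, rfl⟩
    rwa [← hsa.mem_spectrum_eq_re hl]
  set M := sSup σ
  set m := sInf σ
  have hM := hcomp.sSup_mem hne
  have hm := hcomp.sInf_mem hne
  obtain ⟨φ, hφ⟩ := exists_state_apply_eq h (hmem M hM)
  obtain ⟨ψ, hψ⟩ := exists_state_apply_eq h (hmem m hm)
  have hnorm : ‖h - (((M + m) / 2 : ℝ) : ℂ) • 1‖ ≤ (M - m) / 2 := by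
    have hsa' : IsSelfAdjoint (h - (((M + m) / 2 : ℝ) : ℂ) • (1 : A)) := by
      refine hsa.sub (IsSelfAdjoint.smul ?_ (.one _))
      exact Complex.conj_ofReal _
    obtain ⟨l, hl, hl'⟩ := spectrum.exists_nnnorm_eq_spectralRadius
      (h - (((M + m) / 2 : ℝ) : ℂ) • (1 : A))
    rw [hsa'.spectralRadius_eq_nnnorm] at hl'
    have e : ‖l‖ = ‖h - (((M + m) / 2 : ℝ) : ℂ) • (1 : A)‖ :=
      congrArg NNReal.toReal (ENNReal.coe_injective hl')
    rw [← e]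
    rw [← Algebra.algebraMap_eq_smul_one, ← spectrum.sub_singleton_eq] at hl
    obtain ⟨k, hk, _, rfl, rfl⟩ := hl
    have hkre : k.re ∈ σ := ⟨k, hk, rfl⟩
    have h1 := le_csSup hcomp.bddAbove hkre
    have h2 := csInf_le hcomp.bddBelow hkre
    change ‖k - _‖ ≤ _
    rw [hsa.mem_spectrum_eq_re hk, ← Complex.ofReal_sub, Complex.norm_real, Real.norm_eq_abs, abs_le]
    constructor <;> linarith
  -- A spectrum reduced to one point would force `h` to be a scalar.
  have hpos : 0 < M - m := by
    by_contra hle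
    have h0 : ‖h - (((M + m) / 2 : ℝ) : ℂ) • (1 : A)‖ ≤ 0 := by linarith
    exact hns _ (sub_eq_zero.mp (norm_le_zero_iff.mp h0)).symm
  refine ⟨((M - m)⁻¹ : ℂ) • h, ((M - m)⁻¹ * ((M + m) / 2) : ℂ), φ, ψ, ?_, ?_⟩
  · have : ((M - m)⁻¹ : ℂ) • h - ((M - m)⁻¹ * ((M + m) / 2) : ℂ) • (1 : A) =
        (((M - m)⁻¹ : ℝ) : ℂ) • (h - (((M + m) / 2 : ℝ) : ℂ) • 1) := by
      push_cast; rw [smul_sub, smul_smul]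
    rw [this, norm_smul, Complex.norm_real, Real.norm_of_nonneg (by positivity)]
    calc _ ≤ (M - m)⁻¹ * ((M - m) / 2) := by gcongr
      _ = 1 / 2 := by field_simp
  · rw [map_smul, map_smul, hφ, hψ, ← smul_sub, smul_eq_mul]
    refine inv_mul_cancel₀ ?_
    exact_mod_cast hpos.ne'

end States

/-! ### Product states and the two bounds on the distance of states. -/

section ProductState

variable {ι : Type v} [Fintype ι] [DecidableEq ι] {A : ι → Type u} [∀ i, CStarAlgebra (A i)]

/-- The vector state of a unit vector of the underlying Hilbert space. -/
noncomputable def vectorState (x : HilbertTensor (fun i => UniversalSpace (A i))) (hx : ‖x‖ = 1) :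
    State (MinTensor A) :=
  let f : MinTensor A →ₗ[ℂ] ℂ :=
    { toFun := fun T => inner ℂ x (T.1 x)
      map_add' := fun S T => by simp [inner_add_right]
      map_smul' := fun c T => by simp [inner_smul_right] }
  have hf : ∀ T, ‖f T‖ ≤ 1 * ‖T‖ := fun T => by
    refine (norm_inner_le_norm (𝕜 := ℂ) x (T.1 x)).trans ?_
    rw [hx, one_mul, one_mul]
    have := T.1.le_opNorm x
    rwa [hx, mul_one] at this
  have h1 : f 1 = 1 := by
    change inner ℂ x x = 1
    rw [inner_self_eq_norm_sq_to_K, hx]; simp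
  { toCLM := f.mkContinuous 1 hf
    nonneg := fun T => by
      change 0 ≤ inner ℂ x ((star T.1 * T.1) x)
      rw [mul_apply_eq_comp, ContinuousLinearMap.star_eq_adjoint,
        ContinuousLinearMap.adjoint_inner_right, inner_self_eq_norm_sq_to_K,
        RCLike.ofReal_eq_complex_ofReal, ← Complex.ofReal_pow]
      exact Complex.zero_le_real.mpr (sq_nonneg ‖T.1 x‖)
    norm_eq_one := by
      refine le_antisymm (LinearMap.mkContinuous_norm_le _ zero_le_one _) ?_
      have h := (f.mkContinuous 1 hf).le_opNorm 1
      have h2 : ‖(1 : MinTensor A)‖ ≤ 1 := ContinuousLinearMap.norm_id_le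
      rw [LinearMap.mkContinuous_apply, h1, norm_one] at h
      exact h.trans (mul_le_of_le_one_right (norm_nonneg _) h2) }

theorem vectorState_apply (x : HilbertTensor (fun i => UniversalSpace (A i))) (hx : ‖x‖ = 1)
    (T : MinTensor A) : vectorState x hx T = inner ℂ x (T.1 x) := rfl

theorem exists_product_state (φ : ∀ i, State (A i)) :
    ∃ μ : State (MinTensor A), ∀ i a, μ (MinTensor.incl A i a) = φ i a := by
  let w : ∀ i, UniversalSpace (A i) := fun i => (φ i).vector
  have hw : ∀ i, inner ℂ (w i) (w i) = (1 : ℂ) := fun i => by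
    rw [inner_self_eq_norm_sq_to_K, (φ i).norm_vector]; simp
  have hx : ‖(PreTensor.mk w : HilbertTensor fun i => UniversalSpace (A i))‖ = 1 := by
    have h : (inner ℂ (PreTensor.mk w) (PreTensor.mk w) : ℂ) = 1 := by
      rw [inner_mk]; exact Finset.prod_eq_one fun i _ => hw i
    rw [inner_self_eq_norm_sq_to_K] at h
    have : ‖PreTensor.mk w‖ ^ 2 = 1 := Complex.ofReal_injective (by push_cast; exact h)
    rw [UniformSpace.Completion.norm_coe]
    nlinarith [norm_nonneg (PreTensor.mk w)]
  refine ⟨vectorState _ hx, fun i a => ?_⟩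
  rw [vectorState_apply]
  change inner ℂ _ (leg (H := fun i => UniversalSpace (A i)) i (universalRep (A i) a) _) = _
  rw [leg_mk, UniformSpace.Completion.inner_coe, inner_mk, Finset.prod_eq_single i]
  · rw [Function.update_self]
    exact (φ i).inner_vector a
  · intro j _ hj
    rw [Function.update_of_ne hj]
    exact hw j
  · simp

theorem quantumHamming_sum_incl_le {h : ∀ i, A i} {z : ι → ℂ}
    (hz : ∀ i, ‖h i - z i • 1‖ ≤ 1 / 2) :
    quantumHamming A (∑ i, MinTensor.incl A i (h i)) ≤ 1 := by
  refine quantumHamming_le zero_le_one fun i => ?_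
  -- The approximant in the `i`-th subalgebra keeps the other summands and replaces `h i` by its
  -- nearby scalar `z i`; the distance `1/2` is cancelled by the factor `2` in `L_i`.
  have hc : z i • 1 + ∑ j ∈ Finset.univ.erase i, MinTensor.incl A j (h j) ∈ MinTensor.compl A i := by
    refine add_mem ((MinTensor.compl A i).smul_mem (one_mem _) _) (sum_mem fun j hj => ?_)
    refine StarSubalgebra.le_topologicalClosure _ (StarAlgebra.subset_adjoin ℂ _ ?_)
    exact Set.mem_biUnion (Finset.ne_of_mem_erase hj) ⟨h j, rfl⟩
  refine (partialSeminorm_le i _ hc).trans ?_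
  have e : ∑ j, MinTensor.incl A j (h j) -
      (z i • 1 + ∑ j ∈ Finset.univ.erase i, MinTensor.incl A j (h j)) =
      MinTensor.incl A i (h i - z i • 1) := by
    rw [← Finset.add_sum_erase _ _ (Finset.mem_univ i), map_sub, map_smul, map_one]
    abel
  rw [e]
  linarith [NonUnitalStarAlgHom.norm_apply_le (MinTensor.incl A i) (h i - z i • 1), hz i]

theorem stateDist_le (μ ν : State (MinTensor A)) :
    stateDist (quantumHamming A) μ ν ≤ ENNReal.ofReal (Fintype.card ι) := by
  refine iSup₂_le fun a ha => ENNReal.ofReal_le_ofReal ?_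
  obtain ⟨u, hu, h⟩ := μ.exists_norm_sub_le ν a
  obtain ⟨z, hz⟩ := exists_norm_sub_smul_one_le_quantumHamming (realPart (u • a)).2
  have hL := (quantumHamming_realPart_smul_le hu a).trans ha
  have hn : (0 : ℝ) ≤ Fintype.card ι := Nat.cast_nonneg _
  nlinarith [h z]

theorem card_le_of_stateDist_le [∀ i, Nontrivial (A i)] (hA : ∀ i, Module.rank ℂ (A i) ≠ 1) {r : ℝ}
    (hr : 0 ≤ r)
    (h : ∀ μ ν : State (MinTensor A), stateDist (quantumHamming A) μ ν ≤ ENNReal.ofReal r) :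
    (Fintype.card ι : ℝ) ≤ r := by
  choose k z φ ψ hk hφψ using fun i => exists_isSelfAdjoint_states (hA i)
  obtain ⟨μ, hμ⟩ := exists_product_state φ
  obtain ⟨ν, hν⟩ := exists_product_state ψ
  have h1 := le_trans (le_iSup₂ (f := fun a (_ : quantumHamming A a ≤ 1) =>
    ENNReal.ofReal ‖μ a - ν a‖) _ (quantumHamming_sum_incl_le hk)) (h μ ν)
  rw [ENNReal.ofReal_le_ofReal_iff hr, map_sum, map_sum, ← Finset.sum_sub_distrib] at h1
  simpa [hμ, hν, hφψ] using h1

end ProductState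

end QuantumHamming

theorem mainTheorem2 {n : ℕ} (A : Fin n → Type*) [∀ i, CStarAlgebra (A i)]
    [∀ i, Nontrivial (A i)] (hA : ∀ i, Module.rank ℂ (A i) ≠ 1) :
    QuantumHamming.IsDiameter (QuantumHamming.quantumHamming A) (n : ℝ) := by
  refine ⟨n / 2, ⟨⟨by positivity, fun μ ν => ?_, fun a ha => ?_⟩, fun s hs => ?_⟩, by ring⟩
  · have := QuantumHamming.stateDist_le μ ν
    rwa [Fintype.card_fin, ← mul_div_cancel₀ (n : ℝ) two_ne_zero] at this
  · obtain ⟨z, hz⟩ := QuantumHamming.exists_norm_sub_smul_one_le_quantumHamming ha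
    rw [Fintype.card_fin] at hz
    exact (ciInf_le ⟨0, by rintro _ ⟨x, rfl⟩; positivity⟩ z).trans hz
  -- Minimality of `n / 2` uses only the condition on state distances.
  · have := QuantumHamming.card_le_of_stateDist_le hA (mul_nonneg zero_le_two hs.1) hs.2.1
    rw [Fintype.card_fin] at this
    linarith
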